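/- Let $f_0,f_1:\mathbb R\to\mathbb R$ be given by $$f_0(x)=\begin{cases}x/(1-x) & \text{if } 0\le x\le 1/2,\\ 2x & \text{otherwise,}\end{cases}\qquad f_1(x)=1-f_0(1-x).$$ Let $\mathbb P_{1/2}$ be the Bernoulli measure on $\Omega=\{0,1\}^{\infty}$ under which the entries $\omega_1,\omega_2,\dots$ are independent and each equals $0$ or $1$ with probability $1/2$. For $x\in\mathbb R$ let $$F_{1/2}(x)=\mathbb P_{1/2}\big(\{\omega\in\Omega : (f_{\omega_n}\circ\cdots\circ f_{\omega_1})(x)\to+\infty \text{ as } n\to\infty\}\big).$$ Let $?$ denote Minkowski's question mark function: if $x=[a_0;a_1,a_2,\dots]$ is the (finite or infinite) regular continued fraction expansion of the real number $x$, then $$?(x)=a_0+2\sum_{n\ge 1}\frac{(-1)^{n+1}}{2^{a_1+\cdots+a_n}},$$ the sum running over all $n\ge1$ for which $a_n$ exists. Then the following hold. (1) With $a=b=1/2$ and $s=2$: $f_0$ and $f_1$ are continuous and strictly increasing; $0<a\le b<1$, $f_0(0)=0$, $f_0(a)=1$, $f_1(b)=0$, $f_1(1)=1$; $s>1$, $f_0(x)\le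 sx$ for $x\le 0$, $f_0(x)\ge 1+s(x-a)$ for $x\ge a$, $f_1(x)\le s(x-b)$ for $x\le b$, and $f_1(x)\ge 1+s(x-1)$ for $x\ge 1$. Moreover, $f_0(1-x)+f_1(x)=1$ for all $x\in\mathbb R$. (2) For every $x\in\mathbb R$ the event in the definition of $F_{1/2}(x)$ is measurable, and $0\le F_{1/2}(x)\le 1$. Furthermore, $$F_{1/2}(1-x)=1-F_{1/2}(x)\ \text{ for all } x\in\mathbb R,\qquad F_{1/2}\Big(\frac{x}{x+1}\Big)=\frac{F_{1/2}(x)}2\ \text{ for all } x\in[0,1].$$ (3) If $G$ is a real-valued function that is bounded on $[0,1]$ and satisfies $G(1-x)=1-G(x)$ and $G(x/(x+1))=G(x)/2$ for all $x\in[0,1]$, then $G(x)=\,?(x)$ for all $x\in[0,1]$. (4) Consequently, $F_{1/2}(x)=\,?(x)$ for all $x\in[0,1]$. -/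

import Mathlib

open MeasureTheory ProbabilityTheory Filter Topology Set

noncomputable section

namespace RandomIteration

/-- The Bernoulli measure `ℙ_p` on `Ω = {0,1}^∞`: the entries are independent, each of them is `0`
with probability `p` and `1` with probability `1 - p`. The entry `ω_{i+1}` is `ω i`. -/
def bernoulliSeq (p : unitInterval) : Measure (ℕ → Fin 2) :=
  Measure.infinitePi fun _ => bernoulliMeasure (0 : Fin 2) 1 p

/-- The random iterates `x_n = (f_{ω_n} ∘ ⋯ ∘ f_{ω_1}) (x)`, with `x_0 = x`. -/
def orbit (f : Fin 2 → ℝ → ℝ) (ω : ℕ → Fin 2) (x : ℝ) : ℕ → ℝ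
  | 0 => x
  | n + 1 => f (ω n) (orbit f ω x n)

/-- The event that the iterates starting from `x` diverge to plus infinity. -/
def escapeSet (f : Fin 2 → ℝ → ℝ) (x : ℝ) : Set (ℕ → Fin 2) :=
  {ω | Tendsto (orbit f ω x) atTop atTop}

/-- `F_p (x)`: the probability that the iterates starting from `x` diverge to plus infinity. -/
def escapeProb (f : Fin 2 → ℝ → ℝ) (p : unitInterval) (x : ℝ) : ℝ :=
  (bernoulliSeq p).real (escapeSet f x)

/-- The standing assumptions on the pair `(f 0, f 1)`, with constants `a`, `b`, `s`. -/
structure Admissible (f : Fin 2 → ℝ → ℝ) (a b s : ℝ) : Prop where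
  continuous : ∀ i, Continuous (f i)
  strictMono : ∀ i, StrictMono (f i)
  a_pos : 0 < a
  a_le_b : a ≤ b
  b_lt_one : b < 1
  f0_zero : f 0 0 = 0
  f0_a : f 0 a = 1
  f1_b : f 1 b = 0
  f1_one : f 1 1 = 1
  one_lt_s : 1 < s
  f0_le : ∀ x, x ≤ 0 → f 0 x ≤ s * x
  f0_ge : ∀ x, a ≤ x → 1 + s * (x - a) ≤ f 0 x
  f1_le : ∀ x, x ≤ b → f 1 x ≤ s * (x - b)
  f1_ge : ∀ x, 1 ≤ x → 1 + s * (x - 1) ≤ f 1 x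

/-- The symmetry assumption on the pair `(f 0, f 1)`. -/
def Symmetric (f : Fin 2 → ℝ → ℝ) : Prop :=
  ∀ x, f 0 (1 - x) + f 1 x = 1

/-- `f_0 (x) = x / (1 - x)` on `[0, 1/2]`, and `f_0 (x) = 2 x` otherwise. -/
def mink0 (x : ℝ) : ℝ :=
  if 0 ≤ x ∧ x ≤ 1 / 2 then x / (1 - x) else 2 * x

/-- The pair `f_0`, `f_1` with `f_1 (x) = 1 - f_0 (1 - x)`. -/
def mink : Fin 2 → ℝ → ℝ :=
  ![mink0, fun x => 1 - mink0 (1 - x)]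

/-- The probability `1/2`. -/
def oneHalf : unitInterval := ⟨1 / 2, by norm_num, by norm_num⟩

/-- For `x = [a_0; a_1, a_2, …]` (regular continued fraction, finite or infinite), the term
`(-1)^k 2^{-(a_1 + ⋯ + a_{k+1})}`, or `0` if `a_{k+1}` does not exist. In Mathlib's indexing,
`a_{k+1}` is the partial denominator with index `k`. -/
def questionMarkTerm (x : ℝ) (k : ℕ) : ℝ :=
  ((GenContFract.of x).partDens.get? k).elim 0 fun _ =>
    (-1) ^ k * (2 : ℝ) ^ (-∑ i ∈ Finset.range (k + 1),
      ((GenContFract.of x).partDens.get? i).getD 0)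

/-- Minkowski's question mark function,
`?(x) = a_0 + 2 ∑_{n ≥ 1} (-1)^{n+1} 2^{-(a_1 + ⋯ + a_n)}` for `x = [a_0; a_1, a_2, …]`, the sum
running over the partial quotients that exist. -/
def questionMark (x : ℝ) : ℝ :=
  (GenContFract.of x).h + 2 * ∑' k, questionMarkTerm x k

/-- The series that defines `questionMark` converges for every real number. -/
theorem summable_questionMarkTerm (x : ℝ) : Summable (questionMarkTerm x) := by
  refine Summable.of_norm_bounded (g := fun k : ℕ => (1 / 2 : ℝ) ^ (k + 1)) ?_ fun k => ?_
  · exact (summable_nat_add_iff 1).2 (summable_geometric_of_lt_one (by norm_num) (by norm_num))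
  · unfold questionMarkTerm
    cases hk : (GenContFract.of x).partDens.get? k with
    | none => simp
    | some b =>
      have hsum : ((k + 1 : ℕ) : ℝ) ≤ ∑ i ∈ Finset.range (k + 1),
          ((GenContFract.of x).partDens.get? i).getD 0 := by
        have : ∀ i ∈ Finset.range (k + 1),
            (1 : ℝ) ≤ ((GenContFract.of x).partDens.get? i).getD 0 := by
          intro i hi
          obtain ⟨c, hc⟩ := (GenContFract.of x).partDens.ge_stable
            (Nat.lt_succ_iff.1 (Finset.mem_range.1 hi)) hk
          rw [hc]
          exact GenContFract.of_one_le_get?_partDen hc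
        simpa using Finset.card_nsmul_le_sum _ _ _ this
      simp only [Option.elim_some, norm_mul, norm_pow, norm_neg, norm_one, one_pow, one_mul]
      rw [Real.norm_of_nonneg (by positivity), one_div, inv_pow, ← Real.rpow_natCast,
        ← Real.rpow_neg (by norm_num)]
      exact Real.rpow_le_rpow_of_exponent_le (by norm_num) (neg_le_neg hsum)

end RandomIteration

end

/-! Conditioning on the first symbol gives `F = (F ∘ f 0 + F ∘ f 1) / 2`, while `F = 0` on `(-∞, 0]`
and `F = 1` on `[1, ∞)`. As `a = b = 1/2`, one of the two images of any point lies where `F` is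
known, so only one unknown value survives, with weight `1/2`. Hence the bounded defect `F x + F (1 -
x) - 1` is at most half its size elsewhere, and `eq_zero_of_abs_le_half` kills it. The other
functional equation holds because `x / (x + 1)` inverts `f 0` on `[0, 1/2]`, where `f 1 ≤ 0`.

For uniqueness, the two equations combine to `G (1 / (m + y)) = 2 ^ (-m) * (2 - G y)` for integers
`m ≥ 1` and `y` in `[0, 1]`. Peeling off the first partial quotient shows that the question mark
series obeys the same rule with `m = ⌊1 / x⌋` and `y` the image of `x` under the Gauss map. The
difference is therefore at least halved by each step, and the same lemma applies. -/

namespace RandomIteration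

/-- A bounded function whose size at each point is at most half its size at another point of the
same set vanishes on that set. -/
theorem eq_zero_of_abs_le_half {α : Type*} {S : Set α} {D : α → ℝ} {M : ℝ}
    (hM : ∀ x ∈ S, |D x| ≤ M) (h : ∀ x ∈ S, ∃ y ∈ S, |D x| ≤ |D y| / 2) :
    ∀ x ∈ S, D x = 0 := by
  have key : ∀ n : ℕ, ∀ x ∈ S, |D x| ≤ M * (1 / 2) ^ n := by
    intro n
    induction n with
    | zero => simpa using hM
    | succ n ih =>
      intro x hx
      obtain ⟨y, hy, hxy⟩ := h x hx
      have := ih y hy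
      rw [pow_succ]
      linarith
  intro x hx
  have hlim : Tendsto (fun n : ℕ => M * (1 / 2 : ℝ) ^ n) atTop (𝓝 0) := by
    simpa using (tendsto_pow_atTop_nhds_zero_of_lt_one (r := (1 / 2 : ℝ)) (by norm_num)
      (by norm_num)).const_mul M
  exact abs_eq_zero.1 (le_antisymm (ge_of_tendsto' hlim fun n => key n x hx) (abs_nonneg _))

/-! ### Self-similarity of the Bernoulli measure -/

section Bernoulli

instance isProbabilityMeasure_bernoulliSeq (p : unitInterval) :
    IsProbabilityMeasure (bernoulliSeq p) := by
  unfold bernoulliSeq; infer_instance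

/-- Prepend an entry to a sequence. -/
def consSeq (q : Fin 2 × (ℕ → Fin 2)) : ℕ → Fin 2
  | 0 => q.1
  | n + 1 => q.2 n

theorem measurable_consSeq : Measurable consSeq := by
  refine measurable_pi_iff.2 fun n => ?_
  cases n with
  | zero => exact measurable_fst
  | succ n => exact (measurable_pi_apply n).comp measurable_snd

/-- The first entry of a Bernoulli sequence is independent of the others, which again form a
Bernoulli sequence. -/
theorem map_consSeq (p : unitInterval) :
    ((bernoulliMeasure (0 : Fin 2) 1 p).prod (bernoulliSeq p)).map consSeq = bernoulliSeq p := by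
  refine Measure.eq_infinitePi _ fun s t ht => ?_
  classical
  -- A box pulls back to a rectangle; the first entry is constrained only when `0 ∈ s`.
  have hset : consSeq ⁻¹' Set.pi s t =
      (if 0 ∈ s then t 0 else univ) ×ˢ
        Set.pi (s.preimage Nat.succ Nat.succ_injective.injOn : Finset ℕ) fun n => t (n + 1) := by
    ext ⟨i, ω⟩
    simp only [mem_preimage, Set.mem_pi, mem_prod, Finset.mem_coe, Finset.mem_preimage]
    constructor
    · intro h
      refine ⟨?_, fun n hn => h (n + 1) hn⟩
      split_ifs with h0
      · exact h 0 h0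
      · trivial
    · rintro ⟨h0, h1⟩ n hn
      cases n with
      | zero =>
        rw [if_pos hn] at h0
        exact h0
      | succ n => exact h1 n hn
  rw [Measure.map_apply measurable_consSeq (MeasurableSet.pi s.countable_toSet fun i _ => ht i),
    hset, Measure.prod_prod, bernoulliSeq, Measure.infinitePi_pi _ fun i _ => ht (i + 1),
    Finset.prod_preimage' Nat.succ s Nat.succ_injective.injOn
      fun n => bernoulliMeasure (0 : Fin 2) 1 p (t n)]
  have hrange : ∀ n : ℕ, n ∈ range Nat.succ ↔ n ≠ 0 := by
    intro n; rw [Nat.range_succ]; exact Nat.pos_iff_ne_zero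
  simp only [hrange, Finset.filter_ne']
  split_ifs with h0
  · exact Finset.mul_prod_erase s (fun n => bernoulliMeasure (0 : Fin 2) 1 p (t n)) h0
  · rw [Finset.erase_eq_of_notMem h0, measure_univ, one_mul]

theorem bernoulliSeq_real_eq (p : unitInterval) {A : Set (ℕ → Fin 2)} (hA : MeasurableSet A) :
    (bernoulliSeq p).real A = p * (bernoulliSeq p).real {ω | consSeq (0, ω) ∈ A} +
      (1 - p) * (bernoulliSeq p).real {ω | consSeq (1, ω) ∈ A} := by
  have h0 : MeasurableSet (consSeq ⁻¹' A) := measurable_consSeq hA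
  have h : bernoulliSeq p A =
      unitInterval.toNNReal p * bernoulliSeq p {ω | consSeq (0, ω) ∈ A} +
      unitInterval.toNNReal (unitInterval.symm p) * bernoulliSeq p {ω | consSeq (1, ω) ∈ A} := by
    conv_lhs => rw [← map_consSeq, Measure.map_apply measurable_consSeq hA,
      Measure.prod_apply h0, bernoulliMeasure_def]
    rw [lintegral_add_measure, lintegral_smul_measure, lintegral_smul_measure, lintegral_dirac,
      lintegral_dirac]
    rfl
  rw [measureReal_def, h, ENNReal.toReal_add (by finiteness) (by finiteness)]
  simp [measureReal_def]

end Bernoulli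

/-! ### Escape events and first-step analysis -/

section Escape

variable {f : Fin 2 → ℝ → ℝ}

theorem orbit_consSeq (f : Fin 2 → ℝ → ℝ) (i : Fin 2) (ω : ℕ → Fin 2) (x : ℝ) (n : ℕ) :
    orbit f (consSeq (i, ω)) x (n + 1) = orbit f ω (f i x) n := by
  induction n with
  | zero => rfl
  | succ n ih => rw [orbit, ih]; rfl

theorem consSeq_mem_escapeSet {i : Fin 2} {ω : ℕ → Fin 2} {x : ℝ} :
    consSeq (i, ω) ∈ escapeSet f x ↔ ω ∈ escapeSet f (f i x) := by
  rw [escapeSet, mem_ofPred_eq, ← tendsto_add_atTop_iff_nat 1]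
  simp only [orbit_consSeq]
  rfl

theorem measurable_orbit (hf : ∀ i, Measurable (f i)) (x : ℝ) (n : ℕ) :
    Measurable fun ω => orbit f ω x n := by
  induction n with
  | zero => exact measurable_const
  | succ n ih =>
    have : Measurable fun q : Fin 2 × ℝ => f q.1 q.2 :=
      measurable_from_prod_countable_right hf
    exact this.comp ((measurable_pi_apply n).prodMk ih)

theorem measurableSet_escapeSet (hf : ∀ i, Measurable (f i)) (x : ℝ) :
    MeasurableSet (escapeSet f x) :=
  measurableSet_tendsto atTop (measurable_orbit hf x)

theorem escapeProb_mem_Icc (f : Fin 2 → ℝ → ℝ) (p : unitInterval) (x : ℝ) :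
    escapeProb f p x ∈ Icc (0 : ℝ) 1 :=
  ⟨measureReal_nonneg, measureReal_le_one⟩

/-- Dropping the first iterate does not affect divergence, so conditioning on the first symbol
restarts the process at `f 0 x` or `f 1 x`. -/
theorem escapeProb_eq (hf : ∀ i, Measurable (f i)) (p : unitInterval) (x : ℝ) :
    escapeProb f p x = p * escapeProb f p (f 0 x) + (1 - p) * escapeProb f p (f 1 x) := by
  rw [escapeProb, bernoulliSeq_real_eq p (measurableSet_escapeSet hf x)]
  simp only [consSeq_mem_escapeSet]
  rfl

/-- Points of a forward invariant half-line bounded above never escape. -/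
theorem escapeProb_eq_zero (p : unitInterval) {c x : ℝ} (hf : ∀ i, ∀ y ≤ c, f i y ≤ c)
    (hx : x ≤ c) : escapeProb f p x = 0 := by
  have hle : ∀ ω n, orbit f ω x n ≤ c := by
    intro ω n
    induction n with
    | zero => exact hx
    | succ n ih => exact hf _ _ ih
  have : escapeSet f x = ∅ := by
    refine eq_empty_of_forall_notMem fun ω hω => ?_
    obtain ⟨n, hn⟩ := ((show Tendsto (orbit f ω x) atTop atTop from hω).eventually_gt_atTop
      c).exists
    exact (hle ω n).not_gt hn
  rw [escapeProb, this, measureReal_empty]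

/-- Points to the right of `c` always escape if both maps expand the distance from `c` there. -/
theorem escapeProb_eq_one (p : unitInterval) {c s x : ℝ} (hs : 1 < s)
    (hf : ∀ i, ∀ y, c ≤ y → c + s * (y - c) ≤ f i y) (hx : c < x) : escapeProb f p x = 1 := by
  have hge : ∀ ω n, c + s ^ n * (x - c) ≤ orbit f ω x n := by
    intro ω n
    induction n with
    | zero => simp [orbit]
    | succ n ih =>
      have hpos : 0 ≤ s ^ n * (x - c) := by
        have := sub_pos.2 hx
        positivity
      refine le_trans ?_ (hf (ω n) _ (by linarith))
      rw [pow_succ', mul_assoc]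
      gcongr
      linarith
  have : escapeSet f x = univ := by
    refine eq_univ_of_forall fun ω => tendsto_atTop_mono (hge ω) ?_
    exact tendsto_atTop_add_const_left _ _
      ((tendsto_pow_atTop_atTop_of_one_lt hs).atTop_mul_const (sub_pos.2 hx))
  rw [escapeProb, this, probReal_univ]

end Escape

/-! ### The concrete pair of maps -/

section Mink

theorem mink_zero (x : ℝ) : mink 0 x = mink0 x := rfl

theorem mink_one (x : ℝ) : mink 1 x = 1 - mink0 (1 - x) := rfl

/-- The formulas agree at `0` and `1/2`, so each holds on a closed piece; continuity and
monotonicity can then be glued. -/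
theorem mink0_of_nonpos {x : ℝ} (hx : x ≤ 0) : mink0 x = 2 * x := by
  unfold mink0
  split_ifs with h
  · obtain rfl : x = 0 := le_antisymm hx h.1
    norm_num
  · rfl

theorem mink0_of_mem {x : ℝ} (h0 : 0 ≤ x) (h1 : x ≤ 1 / 2) : mink0 x = x / (1 - x) :=
  if_pos ⟨h0, h1⟩

theorem mink0_of_half_le {x : ℝ} (hx : 1 / 2 ≤ x) : mink0 x = 2 * x := by
  unfold mink0
  split_ifs with h
  · obtain rfl : x = 1 / 2 := le_antisymm h.2 hx
    norm_num
  · rfl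

theorem continuous_mink0 : Continuous mink0 := by
  have h : ContinuousOn mink0 (Icc 0 (1 / 2)) := by
    refine ContinuousOn.congr (f := fun x : ℝ => x / (1 - x)) ?_
      fun x hx => mink0_of_mem hx.1 hx.2
    exact continuousOn_id.div (by fun_prop) fun x hx => by have := hx.2; linarith
  have h2 : Continuous fun x : ℝ => 2 * x := by fun_prop
  have hl : ContinuousOn mink0 (Iic 0) := h2.continuousOn.congr fun x hx => mink0_of_nonpos hx
  have hr : ContinuousOn mink0 (Ici (1 / 2)) :=
    h2.continuousOn.congr fun x hx => mink0_of_half_le hx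
  have hu := (hl.union_of_isClosed h isClosed_Iic isClosed_Icc).union_of_isClosed hr
    (isClosed_Iic.union isClosed_Icc) isClosed_Ici
  rw [Iic_union_Icc_eq_Iic (by norm_num), Iic_union_Ici] at hu
  exact continuousOn_univ.1 hu

theorem strictMono_mink0 : StrictMono mink0 := by
  have hl : StrictMonoOn mink0 (Iic 0) := fun x hx y hy hxy => by
    rw [mink0_of_nonpos hx, mink0_of_nonpos hy]; linarith
  have hm : StrictMonoOn mink0 (Icc 0 (1 / 2)) := fun x hx y hy hxy => by
    rw [mink0_of_mem hx.1 hx.2, mink0_of_mem hy.1 hy.2,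
      div_lt_div_iff₀ (by linarith [hx.2]) (by linarith [hy.2])]
    linarith
  have hr : StrictMonoOn mink0 (Ici (1 / 2)) := fun x hx y hy hxy => by
    rw [mink0_of_half_le hx, mink0_of_half_le hy]; linarith
  have h1 : StrictMonoOn mink0 (Iic (1 / 2)) := by
    rw [← Iic_union_Icc_eq_Iic (show (0 : ℝ) ≤ 1 / 2 by norm_num)]
    exact hl.union hm isGreatest_Iic (isLeast_Icc (by norm_num))
  exact h1.Iic_union_Ici hr

theorem admissible_mink : Admissible mink (1 / 2) (1 / 2) 2 := by
  refine ⟨?_, ?_, by norm_num, le_rfl, by norm_num, ?_, ?_, ?_, ?_, by norm_num, ?_, ?_, ?_, ?_⟩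
  · refine Fin.forall_fin_two.2 ⟨continuous_mink0, ?_⟩
    exact continuous_const.sub (continuous_mink0.comp (continuous_const.sub continuous_id))
  · refine Fin.forall_fin_two.2 ⟨strictMono_mink0, fun x y hxy => ?_⟩
    have := strictMono_mink0 (show 1 - y < 1 - x by linarith)
    rw [mink_one, mink_one]
    linarith
  · rw [mink_zero, mink0_of_nonpos le_rfl, mul_zero]
  · rw [mink_zero, mink0_of_half_le le_rfl]; norm_num
  · rw [mink_one, mink0_of_half_le (by norm_num)]; norm_num
  · rw [mink_one, mink0_of_nonpos (by norm_num)]; norm_num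
  · intro x hx
    rw [mink_zero, mink0_of_nonpos hx]
  · intro x hx
    rw [mink_zero, mink0_of_half_le hx]; linarith
  · intro x hx
    rw [mink_one, mink0_of_half_le (by linarith)]; linarith
  · intro x hx
    rw [mink_one, mink0_of_nonpos (by linarith)]; linarith

theorem symmetric_mink : Symmetric mink := fun x => by
  rw [mink_zero, mink_one]; ring

theorem measurable_mink (i : Fin 2) : Measurable (mink i) :=
  (admissible_mink.continuous i).measurable

end Mink

/-! ### Boundary values and symmetry of the escape probability -/

section Admissible

variable {f : Fin 2 → ℝ → ℝ} {a b s : ℝ}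

theorem Admissible.measurable (h : Admissible f a b s) (i : Fin 2) : Measurable (f i) :=
  (h.continuous i).measurable

theorem Admissible.escapeProb_of_nonpos (h : Admissible f a b s) (p : unitInterval) {x : ℝ}
    (hx : x ≤ 0) : escapeProb f p x = 0 := by
  refine escapeProb_eq_zero p (c := 0) (Fin.forall_fin_two.2 ⟨fun y hy => ?_, fun y hy => ?_⟩) hx
  · exact ((h.strictMono 0).monotone hy).trans_eq h.f0_zero
  · exact ((h.strictMono 1).monotone (hy.trans (h.a_pos.le.trans h.a_le_b))).trans_eq h.f1_b

theorem Admissible.escapeProb_of_one_lt (h : Admissible f a b s) (p : unitInterval) {x : ℝ}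
    (hx : 1 < x) : escapeProb f p x = 1 := by
  refine escapeProb_eq_one p h.one_lt_s (Fin.forall_fin_two.2 ⟨fun y hy => ?_, h.f1_ge⟩) hx
  have ha := h.a_le_b.trans h.b_lt_one.le
  refine le_trans ?_ (h.f0_ge y (ha.trans hy))
  have := h.one_lt_s
  gcongr

/-- The point `1` is fixed by `f 1`, so expansion says nothing there; but `f 0 1 > 1` gives `F 1 = p
+ (1 - p) * F 1`. -/
theorem Admissible.escapeProb_of_one_le (h : Admissible f a b s) {p : unitInterval}
    (hp : (p : ℝ) ≠ 0) {x : ℝ} (hx : 1 ≤ x) : escapeProb f p x = 1 := by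
  rcases hx.eq_or_lt with rfl | hx
  · have h0 : 1 < f 0 1 := by
      have := h.strictMono 0 (h.a_le_b.trans_lt h.b_lt_one)
      rwa [h.f0_a] at this
    have := escapeProb_eq h.measurable p 1
    rw [h.escapeProb_of_one_lt p h0, h.f1_one] at this
    have h2 : (p : ℝ) * (escapeProb f p 1 - 1) = 0 := by linarith
    linarith [(mul_eq_zero.1 h2).resolve_left hp]
  · exact h.escapeProb_of_one_lt p hx

theorem escapeProb_oneHalf_eq (h : Admissible f a b s) (x : ℝ) :
    escapeProb f oneHalf x =
      (escapeProb f oneHalf (f 0 x) + escapeProb f oneHalf (f 1 x)) / 2 := by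
  have := escapeProb_eq h.measurable oneHalf x
  simp only [oneHalf] at this ⊢
  linarith

/-- For a symmetric pair with `b ≤ a`, escape to the two sides has complementary probabilities. -/
theorem Admissible.escapeProb_one_sub (h : Admissible f a b s) (hsymm : Symmetric f)
    (hba : b ≤ a) (x : ℝ) :
    escapeProb f oneHalf (1 - x) = 1 - escapeProb f oneHalf x := by
  set F := escapeProb f oneHalf with hF
  have hhalf : (oneHalf : ℝ) ≠ 0 := by norm_num [oneHalf]
  set H : ℝ → ℝ := fun x => F x + F (1 - x) - 1 with hH
  have h0 : ∀ x ≤ 0, H x = 0 := fun x hx => by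
    simp only [hH, hF]
    rw [h.escapeProb_of_nonpos _ hx, h.escapeProb_of_one_le hhalf (by linarith)]
    norm_num
  have h1 : ∀ x, 1 ≤ x → H x = 0 := fun x hx => by
    simp only [hH, hF]
    rw [h.escapeProb_of_nonpos _ (show 1 - x ≤ 0 by linarith), h.escapeProb_of_one_le hhalf hx]
    norm_num
  -- Reflection in `1/2` conjugates `f 0` to `f 1`, so `H` inherits the averaging relation.
  have hrec : ∀ x, H x = (H (f 0 x) + H (f 1 x)) / 2 := fun x => by
    have e0 : f 0 (1 - x) = 1 - f 1 x := by linarith [hsymm x]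
    have e1 : f 1 (1 - x) = 1 - f 0 x := by
      have := hsymm (1 - x)
      rw [sub_sub_cancel] at this
      linarith
    have r0 := escapeProb_oneHalf_eq h x
    have r1 := escapeProb_oneHalf_eq h (1 - x)
    rw [e0, e1] at r1
    simp only [hH, hF]
    linarith
  have hz : H x = 0 := by
    refine eq_zero_of_abs_le_half (S := univ) (M := 1) (fun y _ => ?_) (fun y _ => ?_) x trivial
    · have b0 := escapeProb_mem_Icc f oneHalf y
      have b1 := escapeProb_mem_Icc f oneHalf (1 - y)
      exact abs_le.2 ⟨by simp only [hH, hF]; linarith [b0.1, b1.1],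
        by simp only [hH, hF]; linarith [b0.2, b1.2]⟩
    -- Left of `b`, `f 1 y ≤ 0`; right of `b = a`, `f 0 y ≥ 1`. Either way one term of the average
    -- vanishes.
    · rcases le_total y b with hy | hy
      · refine ⟨f 0 y, trivial, ?_⟩
        rw [hrec y, h0 (f 1 y) (((h.strictMono 1).monotone hy).trans_eq h.f1_b), add_zero,
          abs_div, abs_two]
      · refine ⟨f 1 y, trivial, ?_⟩
        rw [hrec y, h1 (f 0 y) (h.f0_a.symm.trans_le ((h.strictMono 0).monotone
          (h.a_le_b.antisymm hba ▸ hy))), zero_add, abs_div, abs_two]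
  simp only [hH] at hz
  linarith

end Admissible

theorem escapeProb_mink_div_add_one {x : ℝ} (hx : x ∈ Icc (0 : ℝ) 1) :
    escapeProb mink oneHalf (x / (x + 1)) = escapeProb mink oneHalf x / 2 := by
  have hpos : 0 < x + 1 := by linarith [hx.1]
  have hle : x / (x + 1) ≤ 1 / 2 := by
    rw [div_le_div_iff₀ hpos two_pos]; linarith [hx.2]
  have e0 : mink 0 (x / (x + 1)) = x := by
    rw [mink_zero, mink0_of_mem (div_nonneg hx.1 hpos.le) hle]
    field_simp
    ring
  have e1 : mink 1 (x / (x + 1)) ≤ 0 :=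
    ((admissible_mink.strictMono 1).monotone hle).trans_eq admissible_mink.f1_b
  rw [escapeProb_oneHalf_eq admissible_mink, e0, admissible_mink.escapeProb_of_nonpos _ e1,
    add_zero]

/-! ### Continued fractions and uniqueness of the solution -/

section QuestionMark

/-- Removing the first quotient of `x` leads to `x⁻¹`; this allows its replacement by `Int.fract
x⁻¹`, which stays in `[0, 1)`. -/
theorem of_fract_s (v : ℝ) : (GenContFract.of (Int.fract v)).s = (GenContFract.of v).s := by
  rcases eq_or_ne (Int.fract v) 0 with h | h
  · obtain ⟨a, rfl⟩ : ∃ a : ℤ, v = a := ⟨⌊v⌋, eq_of_sub_eq_zero h⟩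
    rw [h, GenContFract.of_s_of_int, ← Int.cast_zero, GenContFract.of_s_of_int]
  · refine Stream'.Seq.ext fun n => ?_
    cases n with
    | zero =>
      have h1 := GenContFract.of_s_head (v := v) h
      have h2 := GenContFract.of_s_head (v := Int.fract v) (by rwa [Int.fract_fract])
      rw [Int.fract_fract] at h2
      exact h2.trans h1.symm
    | succ n => rw [GenContFract.of_s_succ, GenContFract.of_s_succ, Int.fract_fract]

theorem questionMarkTerm_fract (v : ℝ) :
    questionMarkTerm (Int.fract v) = questionMarkTerm v := by
  funext k
  simp only [questionMarkTerm, GenContFract.partDens, of_fract_s]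

theorem of_h_of_mem_Ico {x : ℝ} (hx : x ∈ Ico (0 : ℝ) 1) : (GenContFract.of x).h = 0 := by
  rw [GenContFract.of_h_eq_floor, Int.floor_eq_zero_iff.2 hx, Int.cast_zero]

theorem partDens_get?_zero {x : ℝ} (hx : x ∈ Ioo (0 : ℝ) 1) :
    (GenContFract.of x).partDens.get? 0 = some (⌊x⁻¹⌋ : ℝ) := by
  have hf : Int.fract x = x := Int.fract_eq_self.2 ⟨hx.1.le, hx.2⟩
  have := GenContFract.of_s_head (v := x) (by rw [hf]; exact hx.1.ne')
  rw [hf] at this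
  exact GenContFract.partDen_eq_s_b this

theorem partDens_get?_succ {x : ℝ} (hx : x ∈ Ioo (0 : ℝ) 1) (n : ℕ) :
    (GenContFract.of x).partDens.get? (n + 1) = (GenContFract.of x⁻¹).partDens.get? n := by
  have hf : Int.fract x = x := Int.fract_eq_self.2 ⟨hx.1.le, hx.2⟩
  simp only [GenContFract.partDens, Stream'.Seq.map_get?, GenContFract.of_s_succ, hf]

theorem questionMarkTerm_zero {x : ℝ} (hx : x ∈ Ioo (0 : ℝ) 1) :
    questionMarkTerm x 0 = 2 ^ (-(⌊x⁻¹⌋ : ℝ)) := by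
  simp [questionMarkTerm, partDens_get?_zero hx]

theorem questionMarkTerm_succ {x : ℝ} (hx : x ∈ Ioo (0 : ℝ) 1) (k : ℕ) :
    questionMarkTerm x (k + 1) = -2 ^ (-(⌊x⁻¹⌋ : ℝ)) * questionMarkTerm x⁻¹ k := by
  simp only [questionMarkTerm, partDens_get?_succ hx]
  cases (GenContFract.of x⁻¹).partDens.get? k with
  | none => simp
  | some b =>
    rw [Finset.sum_range_succ']
    simp only [partDens_get?_succ hx, partDens_get?_zero hx, Option.elim_some, Option.getD_some]
    rw [neg_add, Real.rpow_add two_pos]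
    ring

/-- All terms after the first share the factor `-2 ^ (-a₁)` with `a₁ = ⌊x⁻¹⌋`, and what remains is
the series of `x⁻¹`. -/
theorem questionMark_of_mem_Ioo {x : ℝ} (hx : x ∈ Ioo (0 : ℝ) 1) :
    questionMark x = 2 ^ (-(⌊x⁻¹⌋ : ℝ)) * (2 - questionMark (Int.fract x⁻¹)) := by
  rw [questionMark, questionMark, of_h_of_mem_Ico ⟨hx.1.le, hx.2⟩,
    of_h_of_mem_Ico ⟨Int.fract_nonneg _, Int.fract_lt_one _⟩, questionMarkTerm_fract,
    (summable_questionMarkTerm x).tsum_eq_zero_add, questionMarkTerm_zero hx]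
  simp only [questionMarkTerm_succ hx]
  rw [tsum_mul_left]
  ring

theorem questionMark_intCast (a : ℤ) : questionMark a = a := by
  have : questionMarkTerm (a : ℝ) = fun _ => 0 := by
    funext k
    simp [questionMarkTerm, GenContFract.partDens, GenContFract.of_s_of_int]
  rw [questionMark, this, GenContFract.of_h_eq_floor, Int.floor_intCast, tsum_zero, mul_zero,
    add_zero]

theorem abs_questionMarkTerm_le (x : ℝ) (k : ℕ) :
    |questionMarkTerm x k| ≤ (1 / 2 : ℝ) ^ (k + 1) := by
  unfold questionMarkTerm
  cases hk : (GenContFract.of x).partDens.get? k with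
  | none => simp
  | some b =>
    have hsum : ((k + 1 : ℕ) : ℝ) ≤ ∑ i ∈ Finset.range (k + 1),
        ((GenContFract.of x).partDens.get? i).getD 0 := by
      -- Entry `k` exists, hence so do all earlier ones, and the default `0` is never used.
      have : ∀ i ∈ Finset.range (k + 1),
          (1 : ℝ) ≤ ((GenContFract.of x).partDens.get? i).getD 0 := by
        intro i hi
        obtain ⟨c, hc⟩ := (GenContFract.of x).partDens.ge_stable
          (Nat.lt_succ_iff.1 (Finset.mem_range.1 hi)) hk
        rw [hc]
        exact GenContFract.of_one_le_get?_partDen hc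
      simpa using Finset.card_nsmul_le_sum _ _ _ this
    simp only [Option.elim_some, abs_mul, abs_pow, abs_neg, abs_one, one_pow, one_mul]
    rw [abs_of_nonneg (by positivity), one_div, inv_pow, ← Real.rpow_natCast,
      ← Real.rpow_neg (by norm_num)]
    exact Real.rpow_le_rpow_of_exponent_le (by norm_num) (neg_le_neg hsum)

theorem abs_questionMark_le {x : ℝ} (hx : x ∈ Icc (0 : ℝ) 1) : |questionMark x| ≤ 2 := by
  -- At `1` the integer part is `1`; below it, only the series contributes.
  rcases hx.2.eq_or_lt with rfl | h1
  · have := questionMark_intCast 1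
    rw [Int.cast_one] at this
    rw [this]
    norm_num
  · have hs : HasSum (fun k : ℕ => (1 / 2 : ℝ) ^ (k + 1)) 1 := by
      have := hasSum_geometric_two.mul_right (1 / 2 : ℝ)
      norm_num at this ⊢
      simpa [pow_succ] using this
    have := tsum_of_norm_bounded (f := questionMarkTerm x) hs (abs_questionMarkTerm_le x)
    rw [Real.norm_eq_abs] at this
    rw [questionMark, of_h_of_mem_Ico ⟨hx.1, h1⟩, zero_add, abs_mul, abs_two]
    linarith

/-- The values at `1 / (n + 1 + y)` of a solution of the two functional equations. -/
theorem eq_of_functional_equations {G : ℝ → ℝ}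
    (h1 : ∀ x ∈ Icc (0 : ℝ) 1, G (1 - x) = 1 - G x)
    (h2 : ∀ x ∈ Icc (0 : ℝ) 1, G (x / (x + 1)) = G x / 2) {y : ℝ} (hy : y ∈ Icc (0 : ℝ) 1)
    (n : ℕ) : G (n + 1 + y)⁻¹ = (1 / 2) ^ (n + 1) * (2 - G y) := by
  have hy0 := hy.1
  induction n with
  | zero =>
    have hpos : 0 < y + 1 := by linarith
    -- The reflection turns `y / (y + 1)` into `1 / (1 + y)`.
    have e : ((0 : ℕ) + 1 + y)⁻¹ = 1 - y / (y + 1) := by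
      push_cast
      field_simp
      ring
    rw [e, h1 _ ⟨div_nonneg hy0 hpos.le, (div_le_one hpos).2 (by linarith)⟩, h2 y hy]
    ring
  | succ n ih =>
    have hpos : 0 < (n : ℝ) + 1 + y := by positivity
    -- The map `x ↦ x / (x + 1)` sends `1 / t` to `1 / (t + 1)`.
    have e : ((n + 1 : ℕ) + 1 + y)⁻¹ = (n + 1 + y)⁻¹ / ((n + 1 + y)⁻¹ + 1) := by
      push_cast
      field_simp
      ring
    rw [e, h2 _ ⟨by positivity, inv_le_one_of_one_le₀ (by
      have : (0 : ℝ) ≤ n := n.cast_nonneg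
      linarith)⟩, ih]
    ring

/-- A bounded solution of the two functional equations on `[0, 1]` is the question mark
function. -/
theorem eq_questionMark {G : ℝ → ℝ} (hb : ∃ M : ℝ, ∀ x ∈ Icc (0 : ℝ) 1, |G x| ≤ M)
    (h1 : ∀ x ∈ Icc (0 : ℝ) 1, G (1 - x) = 1 - G x)
    (h2 : ∀ x ∈ Icc (0 : ℝ) 1, G (x / (x + 1)) = G x / 2) :
    ∀ x ∈ Icc (0 : ℝ) 1, G x = questionMark x := by
  obtain ⟨M, hM⟩ := hb
  have G0 : G 0 = 0 := by
    have := h2 0 ⟨le_rfl, zero_le_one⟩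
    rw [zero_div] at this
    linarith
  have G1 : G 1 = 1 := by
    have := h1 0 ⟨le_rfl, zero_le_one⟩
    rwa [G0, sub_zero] at this
  have Q0 : questionMark 0 = 0 := by simpa using questionMark_intCast 0
  have Q1 : questionMark 1 = 1 := by simpa using questionMark_intCast 1
  have key : ∀ x ∈ Icc (0 : ℝ) 1, G x - questionMark x = 0 := by
    refine eq_zero_of_abs_le_half (M := M + 2) (fun x hx => ?_) (fun x hx => ?_)
    · exact (abs_sub _ _).trans (add_le_add (hM x hx) (abs_questionMark_le hx))
    -- At the endpoints the difference is zero, so the point is its own witness; inside, the witness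
    -- is its image under the Gauss map.
    · rcases hx.1.eq_or_lt with rfl | hx0
      · exact ⟨0, hx, by simp [G0, Q0]⟩
      rcases hx.2.eq_or_lt with rfl | hx1
      · exact ⟨1, hx, by simp [G1, Q1]⟩
      have hy : Int.fract x⁻¹ ∈ Icc (0 : ℝ) 1 := ⟨Int.fract_nonneg _, (Int.fract_lt_one _).le⟩
      refine ⟨Int.fract x⁻¹, hy, ?_⟩
      have hfl : 1 ≤ ⌊x⁻¹⌋ := Int.le_floor.2 (by
        rw [Int.cast_one]; exact (one_le_inv₀ hx0).2 hx1.le)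
      obtain ⟨n, hn⟩ : ∃ n : ℕ, ⌊x⁻¹⌋ = n + 1 := ⟨(⌊x⁻¹⌋ - 1).toNat, by omega⟩
      have hx' : x = (n + 1 + Int.fract x⁻¹)⁻¹ := by
        have := Int.floor_add_fract x⁻¹
        rw [hn] at this
        push_cast at this
        rw [this, inv_inv]
      have hG : G x = (1 / 2) ^ (n + 1) * (2 - G (Int.fract x⁻¹)) := by
        conv_lhs => rw [hx']
        exact eq_of_functional_equations h1 h2 hy n
      have hQ : questionMark x = (1 / 2) ^ (n + 1) * (2 - questionMark (Int.fract x⁻¹)) := by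
        rw [questionMark_of_mem_Ioo ⟨hx0, hx1⟩, hn, Real.rpow_neg two_pos.le, one_div, inv_pow,
          ← Real.rpow_natCast]
        push_cast
        rfl
      rw [hG, hQ, ← mul_sub, sub_sub_sub_cancel_left, abs_mul, abs_sub_comm,
        abs_of_nonneg (by positivity), pow_succ]
      -- The contraction factor is `(1 / 2) ^ (n + 1)`; the spare power `n` is bounded by `1`.
      have hle : (1 / 2 : ℝ) ^ n ≤ 1 := pow_le_one₀ (by norm_num) (by norm_num)
      have := abs_nonneg (G (Int.fract x⁻¹) - questionMark (Int.fract x⁻¹))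
      nlinarith
  exact fun x hx => sub_eq_zero.1 (key x hx)

end QuestionMark

end RandomIteration

/-- Random iteration of `f_0 (x) = x / (1 - x)` on `[0, 1/2]`, `2 x` otherwise, and
`f_1 (x) = 1 - f_0 (1 - x)`, each with probability `1/2`, yields Minkowski's question mark function
on `[0, 1]`; it is bounded, satisfies the two functional equations, and these properties determine
the question mark function. -/
theorem mainTheorem4 :
    RandomIteration.Admissible RandomIteration.mink (1 / 2) (1 / 2) 2 ∧
    RandomIteration.Symmetric RandomIteration.mink ∧
    (∀ x : ℝ, MeasurableSet (RandomIteration.escapeSet RandomIteration.mink x)) ∧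
    (∀ x : ℝ, RandomIteration.escapeProb RandomIteration.mink RandomIteration.oneHalf x
      ∈ Set.Icc (0 : ℝ) 1) ∧
    (∀ x : ℝ, RandomIteration.escapeProb RandomIteration.mink RandomIteration.oneHalf (1 - x)
      = 1 - RandomIteration.escapeProb RandomIteration.mink RandomIteration.oneHalf x) ∧
    (∀ x ∈ Set.Icc (0 : ℝ) 1,
      RandomIteration.escapeProb RandomIteration.mink RandomIteration.oneHalf (x / (x + 1))
        = RandomIteration.escapeProb RandomIteration.mink RandomIteration.oneHalf x / 2) ∧
    (∀ G : ℝ → ℝ, (∃ M : ℝ, ∀ x ∈ Set.Icc (0 : ℝ) 1, |G x| ≤ M) →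
      (∀ x ∈ Set.Icc (0 : ℝ) 1, G (1 - x) = 1 - G x) →
      (∀ x ∈ Set.Icc (0 : ℝ) 1, G (x / (x + 1)) = G x / 2) →
      ∀ x ∈ Set.Icc (0 : ℝ) 1, G x = RandomIteration.questionMark x) ∧
    (∀ x ∈ Set.Icc (0 : ℝ) 1,
      RandomIteration.escapeProb RandomIteration.mink RandomIteration.oneHalf x
        = RandomIteration.questionMark x) := by
  have hsymm := RandomIteration.admissible_mink.escapeProb_one_sub
    RandomIteration.symmetric_mink le_rfl
  refine ⟨RandomIteration.admissible_mink, RandomIteration.symmetric_mink,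
    RandomIteration.measurableSet_escapeSet RandomIteration.measurable_mink,
    RandomIteration.escapeProb_mem_Icc _ _, hsymm,
    fun x hx => RandomIteration.escapeProb_mink_div_add_one hx,
    fun G hb h1 h2 => RandomIteration.eq_questionMark hb h1 h2, ?_⟩
  refine RandomIteration.eq_questionMark ⟨1, fun x _ => ?_⟩ (fun x _ => hsymm x)
    fun x hx => RandomIteration.escapeProb_mink_div_add_one hx
  have h := RandomIteration.escapeProb_mem_Icc RandomIteration.mink RandomIteration.oneHalf x
  exact abs_le.2 ⟨by linarith [h.1], h.2⟩
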